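/- Let $p$ be a prime and let $(K,v)$ be a valued field with valuation ring $\mathcal O$, maximal ideal $\mathfrak m$ and residue field $k=\mathcal O/\mathfrak m$. Suppose that $(K,v)$ is $p$-henselian in one of the following two senses: (a) Hensel's lemma holds for polynomials of degree $p$: for every monic $f\in\mathcal O[X]$ of degree $p$ and every $a\in\mathcal O$ with $f(a)\in\mathfrak m$ and $f'(a)\notin\mathfrak m$ there is $b\in\mathcal O$ with $f(b)=0$ and $b-a\in\mathfrak m$; or (b) $v$ extends uniquely (up to equivalence) to every finite Galois extension of $K$ of $p$-power degree, and either $p=2$ or $\operatorname{char}K=p$. Suppose that $k$ is infinite, of characteristic $p$, and not Artin–Schreier closed, that is, $\{t^p-t : t\in k\}\neq k$. Then for every $n\geq 1$ the pure field $K$ has $\mathrm{IP}_n$, witnessed by the formula $$\phi(x;y_1,\dots,y_n)\colon\quad \exists t\; x=y_1\cdots y_n\,(t^p-t)$$ in the language of rings. Explicitly: in some model $M$ of the complete theory of $K$ in the language of rings (equivalently, in a monster model) there are elements $a^i_j$ ($1\le i\le n$, $j<\omega$) and $b_J$ ($J\subseteq\omega^n$) such that, for all $J\subseteq\omega^n$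 and $(j_1,\dots,j_n)\in\omega^n$, $$M\models\phi(b_J;a^1_{j_1},\dots,a^n_{j_n})\iff (j_1,\dots,j_n)\in J .$$ -/

import Mathlib

universe u v w

open FirstOrder

/-! ### The independence property of order `n` -/

/-- For a complete theory `T`, the formula `φ(x; y₁, …, yₙ)`, with a tuple `x` of variables indexed
by `α` and tuples `y₁, …, yₙ` of variables indexed by `β`, has the independence property of order
`n`: in some model of `T` there are parameters `a k i` (for `1 ≤ k ≤ n`, `i < ω`) and `b J`
(for `J ⊆ ω ^ n`) such that `φ(b J; a 1 i₁, …, a n iₙ)` holds if and only if `(i₁, …, iₙ) ∈ J`.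
As `T` is complete, "in some model" means the same as "in a monster model". -/
def FirstOrder.Language.Theory.FormulaHasIP {L : Language.{u, v}} (T : L.Theory) {n : ℕ}
    {α β : Type} (φ : L.Formula (α ⊕ (Fin n × β))) : Prop :=
  ∃ (M : Language.Theory.ModelType.{u, v, max u v} T)
    (a : Fin n → ℕ → β → M) (b : Set (Fin n → ℕ) → α → M),
    ∀ (J : Set (Fin n → ℕ)) (i : Fin n → ℕ),
      φ.Realize (Sum.elim (b J) (fun kj => a kj.1 (i kj.1) kj.2)) ↔ i ∈ J

/-- A complete theory has `IP_n` if one of its formulas, in finitely many variables, does. -/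
def FirstOrder.Language.Theory.HasIP {L : Language.{u, v}} (T : L.Theory) (n : ℕ) : Prop :=
  ∃ (r s : ℕ) (φ : L.Formula (Fin r ⊕ (Fin n × Fin s))), T.FormulaHasIP φ

/-- The complete theory of the pure field `K`, in the language of rings. -/
def pureFieldTheory (K : Type u) [Field K] : Language.ring.Theory :=
  letI := Ring.compatibleRingOfRing K
  Language.ring.completeTheory K

/-! ### The formula `∃ t, x = y₁ ⋯ yₙ (t ^ p - t)` -/

/-- The formula `∃ t, x = y₁ ⋯ yₙ (t ^ p - t)` in the language of rings. -/
def artinSchreierFormula (n p : ℕ) :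
    Language.ring.Formula (Fin 1 ⊕ (Fin n × Fin 1)) :=
  let x : Language.ring.Term ((Fin 1 ⊕ (Fin n × Fin 1)) ⊕ Fin 1) :=
    Language.Term.var (Sum.inl (Sum.inl 0))
  let y : Fin n → Language.ring.Term ((Fin 1 ⊕ (Fin n × Fin 1)) ⊕ Fin 1) :=
    fun k => Language.Term.var (Sum.inl (Sum.inr (k, 0)))
  let t : Language.ring.Term ((Fin 1 ⊕ (Fin n × Fin 1)) ⊕ Fin 1) :=
    Language.Term.var (Sum.inr 0)
  (Language.Term.bdEqual x
    ((List.ofFn y).prod * ((List.replicate p t).prod + -t))).ex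

theorem realize_list_prod {K : Type u} [Field K] [Ring.CompatibleRing K] {γ : Type w}
    (l : List (Language.ring.Term γ)) (e : γ → K) :
    l.prod.realize e = (l.map (fun s => s.realize e)).prod := by
  induction l with
  | nil => simp
  | cons s l ih => simp [ih]

/-- The formula says what it should in every field. -/
theorem realize_artinSchreierFormula {K : Type u} [Field K] [Ring.CompatibleRing K] (n p : ℕ)
    (e : Fin 1 ⊕ (Fin n × Fin 1) → K) :
    (artinSchreierFormula n p).Realize e ↔
      ∃ t : K, e (Sum.inl 0) = (∏ k, e (Sum.inr (k, 0))) * (t ^ p - t) := by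
  simp [artinSchreierFormula, Language.Formula.Realize, realize_list_prod, List.map_ofFn,
    List.prod_ofFn, sub_eq_add_neg, Fin.snoc]

/-! ### Valued fields -/

/-- `p`-henselianity as a root lifting property: Hensel's lemma holds for the polynomials of
degree `p`. Every monic polynomial of degree `p` over the valuation ring and every simple root of
its reduction lift to a root. -/
def IsPHenselian {K : Type u} [Field K] {Γ : Type v} [LinearOrderedCommGroupWithZero Γ]
    (val : Valuation K Γ) (p : ℕ) : Prop :=
  ∀ f : Polynomial val.valuationSubring, f.Monic → f.natDegree = p →
    ∀ a : val.valuationSubring,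
      f.eval a ∈ IsLocalRing.maximalIdeal val.valuationSubring →
      f.derivative.eval a ∉ IsLocalRing.maximalIdeal val.valuationSubring →
      ∃ b : val.valuationSubring, f.IsRoot b ∧
        b - a ∈ IsLocalRing.maximalIdeal val.valuationSubring

/-- `p`-henselianity through extensions: the valuation extends uniquely (up to equivalence, that
is, as a valuation ring) to every finite Galois extension of `p`-power degree. -/
def ExtendsUniquelyToPExtensions {K : Type u} [Field K] {Γ : Type v}
    [LinearOrderedCommGroupWithZero Γ] (val : Valuation K Γ) (p : ℕ) : Prop :=
  ∀ (L : Type u) [Field L] [Algebra K L] [FiniteDimensional K L] [IsGalois K L],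
    (∃ r : ℕ, Module.finrank K L = p ^ r) →
      ∃! B : ValuationSubring L, B.comap (algebraMap K L) = val.valuationSubring

/-- A field `k` of characteristic `p` is Artin–Schreier closed if every polynomial `t ^ p - t - c`
with `c` in `k` has a root in `k`. -/
def IsASClosed (k : Type u) [Field k] (p : ℕ) : Prop :=
  ∀ c : k, ∃ t : k, t ^ p - t = c

/-!
Write `℘(t) = t ^ p - t`. By compactness it is enough to find the pattern in `K` itself, for
parameters indexed by the finite cubes `{0, …, m - 1} ^ n` (`FormulaHasIP.of_finite`).

Either form of `p`-henselianity gives Hensel's lemma for the polynomials `X ^ p - X - c` with `c`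
integral. Hence for such `c` the equation `℘(t) = c` is solvable in `K` if and only if its reduction
is solvable in the residue field `k` (`exists_pow_sub_self_eq_iff_residue`). If the parameters
`a k j` are inverses of units, the whole question therefore takes place in `k`: one needs elements
`c_i` of `k`, indexed by the cube and with `c_i` a product of factors depending on one coordinate
each, such that for every subset `J` of the cube some `b` satisfies `c_i b ∈ ℘(k) ↔ i ∈ J`.

The heart of the matter is that, for `𝔽_p`-linearly independent `γ_i` and a suitable power `q` of
`p`, the powers `c_i = γ_i ^ q` always have this property
(`exists_forall_mul_mem_range_artinSchreierHom_iff`). As `℘(k)` is an additive group, it suffices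
to find, for a given `i`, some `b` with `c_j b ∈ ℘(k)` for `j ≠ i` and `c_i b ∉ ℘(k)`. Let `g` be
the additive polynomial whose roots are the `𝔽_p`-span of the `γ_j` with `j ≠ i`. Modulo `℘(k)`
every element of `k` is congruent to its `p`-th power, so each monomial of `g` has an adjoint, and
there is a function `F` with `γ ^ q F(s) ≡ g(γ) s` modulo `℘(k)`, for all `γ` and `s`
(`exists_additive_adjoint`). Then `c_j F(s) ≡ g(γ_j) s = 0` for `j ≠ i`, whereas
`c_i F(s) ≡ g(γ_i) s` with `g(γ_i) ≠ 0` takes every value modulo `℘(k)`, and `℘(k) ≠ k`.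

Finally, `k` is infinite, so it contains some `x` whose first `m ^ n` powers are linearly
independent over `𝔽_p`. Expanding exponents in base `m` writes these powers as products over the
coordinates of the cube.
-/

open Polynomial

/-! ### Compactness -/

/-- Compactness for sets of formulas: if every member of a directed family of sets of formulas is
realised in some model of `T`, then so is their union. -/
theorem FirstOrder.Language.Theory.exists_realize_iUnion {L : Language.{u, v}} {T : L.Theory}
    {γ : Type w} {ι : Type*} [Nonempty ι] {S : ι → Set (L.Formula γ)}
    (hS : Directed (· ⊆ ·) S) (M : Type*) [L.Structure M] [M ⊨ T] [Nonempty M]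
    (h : ∀ i, ∃ e : γ → M, ∀ φ ∈ S i, φ.Realize e) :
    ∃ (N : Language.Theory.ModelType.{u, v, max u v w} T) (e : γ → N),
      ∀ i, ∀ φ ∈ S i, φ.Realize e := by
  let T' : ι → L[[γ]].Theory := fun i =>
    (L.lhomWithConstants γ).onTheory T ∪ Language.Formula.equivSentence '' S i
  have hT' : Language.Theory.IsSatisfiable (⋃ i, T' i) := by
    rw [Language.Theory.isSatisfiable_directed_union_iff]
    · intro i
      obtain ⟨e, he⟩ := h i
      let := Language.constantsOn.structure e
      have : M ⊨ T' i := by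
        refine Language.Theory.Model.union ((Language.LHom.onTheory_model _ T).2 ‹_›) ?_
        rw [Language.Theory.model_iff]
        rintro _ ⟨φ, hφ, rfl⟩
        exact (Language.Formula.realize_equivSentence M φ).2 (he φ hφ)
      exact Language.Theory.Model.isSatisfiable M
    · intro i j
      obtain ⟨l, hi, hj⟩ := hS i j
      exact ⟨l, Set.union_subset_union_right _ (Set.image_mono hi),
        Set.union_subset_union_right _ (Set.image_mono hj)⟩
  obtain ⟨N⟩ := hT'
  obtain ⟨i₀⟩ := ‹Nonempty ι›
  let : L.Structure N := (L.lhomWithConstants γ).reduct N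
  have : (L.lhomWithConstants γ).IsExpansionOn N := Language.LHom.isExpansionOn_reduct _ _
  have : N ⊨ T := by
    refine (Language.LHom.onTheory_model (L.lhomWithConstants γ) T).1
      (Language.Theory.Model.mono N.is_model ?_)
    exact Set.subset_union_left.trans (Set.subset_iUnion T' i₀)
  refine ⟨Language.Theory.ModelType.of T N, fun c => (L.con c : N), fun i φ hφ => ?_⟩
  refine (Language.Formula.realize_equivSentence N φ).1 ?_
  exact Language.Theory.realize_sentence_of_mem (⋃ i, T' i)
    (Set.mem_iUnion.2 ⟨i, Or.inr ⟨φ, hφ, rfl⟩⟩)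

/-- By compactness, the independence property of order `n` for a formula over the complete theory
of `M` can be checked in `M` itself, on the finite cubes `{0, …, m - 1} ^ n`. -/
theorem FirstOrder.Language.Theory.FormulaHasIP.of_finite {L : Language.{0, 0}} {M : Type*}
    [L.Structure M] [Nonempty M] {n : ℕ} {α β : Type} {φ : L.Formula (α ⊕ (Fin n × β))}
    (h : ∀ m : ℕ, ∃ (a : Fin n → ℕ → β → M) (b : Set (Fin n → ℕ) → α → M),
      ∀ (J : Set (Fin n → ℕ)) (i : Fin n → ℕ), (∀ k, i k < m) →
        (φ.Realize (Sum.elim (b J) (fun kj => a kj.1 (i kj.1) kj.2)) ↔ i ∈ J)) :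
    (L.completeTheory M).FormulaHasIP φ := by
  classical
  -- One variable for every coordinate of every parameter, and one instance of `φ` or of its
  -- negation for every pair `(J, i)`.
  let var : Set (Fin n → ℕ) → (Fin n → ℕ) → α ⊕ (Fin n × β) →
      (Set (Fin n → ℕ) × α) ⊕ (Fin n × ℕ × β) :=
    fun J i => Sum.map (fun x => (J, x)) (fun kj => (kj.1, i kj.1, kj.2))
  let inst : Set (Fin n → ℕ) → (Fin n → ℕ) →
      L.Formula ((Set (Fin n → ℕ) × α) ⊕ (Fin n × ℕ × β)) :=
    fun J i => if i ∈ J then φ.relabel (var J i) else (φ.relabel (var J i)).not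
  let S : ℕ → Set (L.Formula ((Set (Fin n → ℕ) × α) ⊕ (Fin n × ℕ × β))) :=
    fun m => {ψ | ∃ J i, (∀ k, i k < m) ∧ ψ = inst J i}
  have hS : Monotone S := by
    rintro m m' hm _ ⟨J, i, hi, rfl⟩
    exact ⟨J, i, fun k => (hi k).trans_le hm, rfl⟩
  obtain ⟨N, e, he⟩ := Language.Theory.exists_realize_iUnion (T := L.completeTheory M)
    hS.directed_le M (by
      intro m
      obtain ⟨a, b, hab⟩ := h m
      refine ⟨Sum.elim (fun x => b x.1 x.2) (fun x => a x.1 x.2.1 x.2.2), ?_⟩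
      rintro _ ⟨J, i, hi, rfl⟩
      have hJ := hab J i hi
      have hv : Sum.elim (fun x => b x.1 x.2) (fun x => a x.1 x.2.1 x.2.2) ∘ var J i =
          Sum.elim (b J) (fun kj => a kj.1 (i kj.1) kj.2) := by
        ext (x | x) <;> rfl
      by_cases hi' : i ∈ J <;> simpa [inst, hi', hv, Language.Formula.realize_relabel] using hJ)
  refine ⟨N, fun k j y => e (Sum.inr (k, j, y)), fun J x => e (Sum.inl (J, x)), fun J i => ?_⟩
  have hJ := he (Finset.univ.sup i + 1) (inst J i) ⟨J, i, fun k =>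
    Nat.lt_succ_of_le (Finset.le_sup (f := i) (Finset.mem_univ k)), rfl⟩
  have hv : e ∘ var J i = Sum.elim (fun x => e (Sum.inl (J, x)))
      (fun kj => e (Sum.inr (kj.1, i kj.1, kj.2))) := by
    ext (x | x) <;> rfl
  by_cases hi : i ∈ J <;> simpa [inst, hi, hv, Language.Formula.realize_relabel] using hJ

/-! ### Independence of Artin–Schreier subgroups in characteristic `p` -/

section
variable {k : Type*} [Field k] (p : ℕ)

/-- The Artin–Schreier map `t ↦ t ^ p - t` of a field of characteristic `p`, as an additive
homomorphism. -/
def artinSchreierHom [Fact p.Prime] [CharP k p] : k →+ k :=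
  (frobenius k p : k →+ k) - AddMonoidHom.id k

variable [hp : Fact p.Prime] [CharP k p]

@[simp]
theorem artinSchreierHom_apply (t : k) : artinSchreierHom p t = t ^ p - t := by
  simp [artinSchreierHom, frobenius_def]

theorem pow_sub_self_mem_range_artinSchreierHom (t : k) :
    t ^ p - t ∈ (artinSchreierHom p : k →+ k).range := ⟨t, by simp⟩

theorem exists_natCast_eq_of_pow_eq_self {x : k} (hx : x ^ p = x) : ∃ i : ℕ, (i : k) = x := by
  have := (Subfield.mem_bot_iff_pow_eq_self (F := k) (p := p)).2 hx
  rw [← ZMod.fieldRange_castHom_eq_bot p] at this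
  obtain ⟨y, rfl⟩ := this
  exact ⟨y.val, by simp⟩

/-- For linearly independent `γ₁, …, γ_N` in `k` there is an additive map `g` that vanishes exactly
on the `𝔽_p`-span of the `γⱼ`, and whose `p ^ r`-th powers have adjoints `F` modulo `℘(k)`, in the
sense that `x ^ (p ^ (N + r)) F(y) ≡ g(x) ^ (p ^ r) y` for all `x` and `y`. The map `g` is an
additive polynomial of degree `p ^ N`; adding `γ` to the family replaces `g` by `℘ ∘ (g / g(γ))`,
because `𝔽_p` is the kernel of `℘`. The induction step for `r` uses the case of `r + 1`. -/
theorem exists_additive_adjoint [Algebra (ZMod p) k] {ι : Type*} (γ : ι → k) (s : Finset ι)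
    (hγ : LinearIndepOn (ZMod p) γ (s : Set ι)) :
    ∃ g : k →+ k, (∀ x, g x = 0 ↔ x ∈ Submodule.span (ZMod p) (γ '' s)) ∧
      ∀ r : ℕ, ∃ F : k → k, ∀ x y : k,
        x ^ p ^ (s.card + r) * F y - g x ^ p ^ r * y ∈ (artinSchreierHom p : k →+ k).range := by
  classical
  induction s using Finset.induction_on with
  | empty => exact ⟨AddMonoidHom.id k, by simp, fun r => ⟨id, fun x y => by simp⟩⟩
  | insert j s hj ih =>
    have hγ' : LinearIndepOn (ZMod p) γ (insert j (s : Set ι)) := by simpa using hγ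
    obtain ⟨g, hg, hF⟩ := ih (hγ'.mono (Set.subset_insert _ _))
    have hj' : γ j ∉ Submodule.span (ZMod p) (γ '' s) :=
      ((linearIndepOn_insert (by simpa using hj)).1 hγ').2
    have hc : g (γ j) ≠ 0 := fun h => hj' ((hg _).1 h)
    set c := g (γ j) with hc_def
    have hlin : ∀ (i : ℕ) x, g ((i : ZMod p) • x) = i * g x := by
      intro i x
      rw [Nat.cast_smul_eq_nsmul, map_nsmul, nsmul_eq_mul]
    refine ⟨(artinSchreierHom p).comp ((AddMonoidHom.mulRight c⁻¹).comp g), fun x => ?_,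
      fun r => ?_⟩
    · rw [Finset.coe_insert, Set.image_insert_eq, Submodule.mem_span_insert]
      simp only [AddMonoidHom.comp_apply, artinSchreierHom_apply, AddMonoidHom.mulRight_apply,
        sub_eq_zero]
      constructor
      · intro h
        obtain ⟨i, hi⟩ := exists_natCast_eq_of_pow_eq_self p h
        refine ⟨i, x - (i : ZMod p) • γ j, (hg _).1 ?_, by abel⟩
        rw [map_sub, hlin, hi, ← hc_def]
        field_simp
        simp
      · rintro ⟨a, z, hz, rfl⟩
        obtain ⟨i, rfl⟩ : ∃ i : ℕ, (i : ZMod p) = a := ⟨a.val, by simp⟩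
        rw [map_add, hlin, (hg z).2 hz, ← hc_def, add_zero, mul_assoc, mul_inv_cancel₀ hc,
          mul_one, ← frobenius_def, map_natCast]
    · obtain ⟨F, hF⟩ := hF (r + 1)
      refine ⟨fun y => F ((y - y ^ p) / c ^ p ^ (r + 1)), fun x y => ?_⟩
      -- With `h = g x / c`, the second relation replaces `h ^ (p ^ r) y` by its `p`-th power, so
      -- that `(h ^ p - h) ^ (p ^ r) y ≡ h ^ (p ^ (r + 1)) (y - y ^ p)`, to which the first one applies.
      have h1 := hF x ((y - y ^ p) / c ^ p ^ (r + 1))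
      have h2 := pow_sub_self_mem_range_artinSchreierHom p ((g x * c⁻¹) ^ p ^ r * y)
      rw [Finset.card_insert_of_notMem hj, add_right_comm, add_assoc]
      convert sub_mem h1 h2 using 1
      simp only [AddMonoidHom.comp_apply, artinSchreierHom_apply, AddMonoidHom.mulRight_apply]
      rw [sub_pow_char_pow, ← pow_mul, ← pow_succ', mul_pow _ y p, ← pow_mul, ← pow_succ]
      have : g x ^ p ^ (r + 1) * ((y - y ^ p) / c ^ p ^ (r + 1)) =
          (g x * c⁻¹) ^ p ^ (r + 1) * (y - y ^ p) := by
        rw [mul_pow, inv_pow]; ring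
      rw [this]
      ring

/-- Over a field that is not Artin–Schreier closed, a vector outside the `𝔽_p`-span of linearly
independent vectors is separated from them by the subgroups `γ ^ (-q) ℘(k)`. -/
theorem exists_mem_range_artinSchreierHom_and_notMem [Algebra (ZMod p) k] {ι : Type*} (γ : ι → k)
    (s : Finset ι) (hγ : LinearIndepOn (ZMod p) γ (s : Set ι)) {x : k}
    (hx : x ∉ Submodule.span (ZMod p) (γ '' s)) (hAS : ∃ c : k, ∀ t : k, t ^ p - t ≠ c) :
    ∃ b : k, (∀ j ∈ s, γ j ^ p ^ s.card * b ∈ (artinSchreierHom p : k →+ k).range) ∧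
      x ^ p ^ s.card * b ∉ (artinSchreierHom p : k →+ k).range := by
  obtain ⟨g, hg, hF⟩ := exists_additive_adjoint p γ s hγ
  obtain ⟨F, hF⟩ := hF 0
  simp only [add_zero, pow_zero, pow_one] at hF
  obtain ⟨c, hc⟩ := hAS
  have hgx : g x ≠ 0 := fun h => hx ((hg x).1 h)
  refine ⟨F (c / g x), fun j hj => ?_, fun h => ?_⟩
  · have := hF (γ j) (c / g x)
    rwa [(hg (γ j)).2 (Submodule.subset_span ⟨j, hj, rfl⟩), zero_mul, sub_zero] at this
  · have := sub_mem h (hF x (c / g x))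
    rw [sub_sub_cancel, mul_div_cancel₀ _ hgx] at this
    obtain ⟨t, ht⟩ := this
    exact hc t (by simpa using ht)

/-- Linearly independent elements of a field that is not Artin–Schreier closed give, after raising
to a power of `p`, a family of subgroups `γ ^ (-q) ℘(k)` that is independent: elements exist which
belong to any prescribed members of the family and to no others. -/
theorem exists_forall_mul_mem_range_artinSchreierHom_iff [Algebra (ZMod p) k] {ι : Type*}
    [Fintype ι] (γ : ι → k) (hγ : LinearIndependent (ZMod p) γ)
    (hAS : ∃ c : k, ∀ t : k, t ^ p - t ≠ c) :
    ∃ q : ℕ, ∀ J : Set ι, ∃ b : k, ∀ j,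
      γ j ^ q * b ∈ (artinSchreierHom p : k →+ k).range ↔ j ∈ J := by
  classical
  -- For each `i` the other `γ j` span a space of dimension `Fintype.card ι - 1`.
  refine ⟨p ^ (Fintype.card ι - 1), fun J => ?_⟩
  have h : ∀ i : ι, ∃ b : k, (∀ j, j ≠ i →
      γ j ^ p ^ (Fintype.card ι - 1) * b ∈ (artinSchreierHom p : k →+ k).range) ∧
      γ i ^ p ^ (Fintype.card ι - 1) * b ∉ (artinSchreierHom p : k →+ k).range := by
    intro i
    obtain ⟨b, hb, hb'⟩ := exists_mem_range_artinSchreierHom_and_notMem p γ (Finset.univ.erase i)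
      (hγ.linearIndepOn _) (x := γ i) (hγ.notMem_span_image (by simp)) hAS
    rw [Finset.card_erase_of_mem (Finset.mem_univ i), Finset.card_univ] at hb hb'
    exact ⟨b, fun j hj => hb j (by simpa using hj), hb'⟩
  choose b hb hb' using h
  -- Modulo `γ j ^ (-q) ℘(k)` this sum is `b j` if `j ∉ J`, and vanishes otherwise.
  refine ⟨∑ i with i ∉ J, b i, fun j => ?_⟩
  rw [Finset.mul_sum]
  by_cases hj : j ∈ J
  · refine iff_of_true (sum_mem fun i hi => hb i j ?_) hj
    rintro rfl
    exact (Finset.mem_filter.1 hi).2 hj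
  · refine iff_of_false (fun h => ?_) hj
    rw [← Finset.add_sum_erase _ _ (show j ∈ Finset.univ.filter (· ∉ J) by simpa using hj)] at h
    refine hb' j ((AddSubgroup.add_mem_cancel_right _ (sum_mem fun i hi => hb i j ?_)).1 h)
    exact (Finset.ne_of_mem_erase hi).symm

end

/-- An infinite field of characteristic `p` contains elements whose degree over `𝔽_p` is
arbitrarily large. -/
theorem exists_linearIndependent_pow (k : Type*) [Field k] [Infinite k] (p : ℕ)
    [Fact p.Prime] [Algebra (ZMod p) k] (D : ℕ) :
    ∃ x : k, x ≠ 0 ∧ LinearIndependent (ZMod p) (fun i : Fin D => x ^ (i : ℕ)) := by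
  classical
  let f : (Fin D → ZMod p) → k[X] :=
    fun c => ∑ i : Fin D, C (algebraMap (ZMod p) k (c i)) * X ^ (i : ℕ)
  have hcoeff : ∀ c (i : Fin D), (f c).coeff i = algebraMap (ZMod p) k (c i) := by
    intro c i
    simp [f, finsetSum_coeff, coeff_C_mul, coeff_X_pow, Fin.val_inj]
  obtain ⟨x, hx⟩ := Infinite.exists_notMem_finset
    (insert 0 (Finset.univ.biUnion fun c => (f c).roots.toFinset))
  simp only [Finset.mem_insert, Finset.mem_biUnion, Finset.mem_univ, true_and, not_or,
    not_exists, Multiset.mem_toFinset] at hx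
  refine ⟨x, hx.1, Fintype.linearIndependent_iff.2 fun c hc i => ?_⟩
  by_contra hi
  have hne : f c ≠ 0 := fun h0 => hi <| by simpa [h0] using (hcoeff c i).symm
  refine hx.2 c ((mem_roots hne).2 ?_)
  simpa [f, IsRoot, eval_finsetSum, Algebra.smul_def] using hc

/-! ### Hensel's lemma for Artin–Schreier polynomials -/

section
variable {R : Type*} [CommRing R] [IsLocalRing R] {p : ℕ}

/-- Roots of `X ^ p - X - c` in a local domain of residue characteristic `p` are simple modulo
the maximal ideal, so congruent ones are equal. -/
theorem eq_of_pow_sub_self_eq_of_sub_mem [IsDomain R] [CharP (IsLocalRing.ResidueField R) p]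
    {t u : R} (h : t ^ p - t = u ^ p - u) (htu : t - u ∈ IsLocalRing.maximalIdeal R) : t = u := by
  have hfac : (t - u) * (∑ i ∈ Finset.range p, t ^ i * u ^ (p - 1 - i) - 1) = 0 := by
    have := (Commute.all t u).mul_geom_sum₂ p
    linear_combination this + h
  have hres : IsLocalRing.residue R t = IsLocalRing.residue R u := by
    rwa [← sub_eq_zero, ← map_sub, IsLocalRing.residue_eq_zero_iff]
  have hunit : IsUnit (∑ i ∈ Finset.range p, t ^ i * u ^ (p - 1 - i) - 1) := by
    rw [← IsLocalRing.residue_ne_zero_iff_isUnit]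
    simp only [map_sub, map_sum, map_mul, map_pow, map_one, hres]
    rw [geom_sum₂_self, CharP.cast_eq_zero, zero_mul, zero_sub]
    exact neg_ne_zero.2 one_ne_zero
  exact sub_eq_zero.1 (hunit.mul_left_eq_zero.1 hfac)

end

theorem ValuationSubring.mem_of_pow_sub_self_mem {F : Type*} [Field F] (A : ValuationSubring F)
    {p : ℕ} (hp : p.Prime) {t : F} (h : t ^ p - t ∈ A) : t ∈ A := by
  rcases A.mem_or_inv_mem t with ht | ht
  · exact ht
  rcases eq_or_ne t 0 with rfl | h0
  · exact A.zero_mem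
  obtain ⟨m, rfl⟩ := Nat.exists_eq_add_of_le hp.two_le
  have : t = (1 + (t ^ (2 + m) - t) * t⁻¹) * t⁻¹ ^ m := by
    rw [pow_add, inv_pow]
    field_simp
    ring
  rw [this]
  exact A.mul_mem _ _ (A.add_mem _ _ A.one_mem (A.mul_mem _ _ h ht)) (pow_mem ht m)

section
variable {K : Type u} [Field K] {Γ : Type v} [LinearOrderedCommGroupWithZero Γ]
  {val : Valuation K Γ} {p : ℕ}

/-- Hensel's lemma for Artin–Schreier polynomials. -/
theorem IsPHenselian.exists_pow_sub_self_eq (h : IsPHenselian val p) (hp : p.Prime)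
    [CharP (IsLocalRing.ResidueField val.valuationSubring) p] {a c : val.valuationSubring}
    (hac : a ^ p - a - c ∈ IsLocalRing.maximalIdeal val.valuationSubring) :
    ∃ t : K, t ^ p - t = c := by
  have hdeg : (X + C c : val.valuationSubring[X]).natDegree < p := by
    rw [natDegree_X_add_C]
    exact hp.one_lt
  have hmonic : (X ^ p - (X + C c) : val.valuationSubring[X]).Monic :=
    monic_X_pow_sub (degree_le_natDegree.trans_lt (by exact_mod_cast hdeg))
  have hf : (X ^ p - (X + C c) : val.valuationSubring[X]).natDegree = p := by
    rw [natDegree_sub_eq_left_of_natDegree_lt (by rwa [natDegree_X_pow]), natDegree_X_pow]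
  obtain ⟨b, hb, -⟩ := h _ hmonic hf a (by simpa [sub_sub] using hac) (by
    rw [← IsLocalRing.residue_eq_zero_iff, derivative_sub, derivative_X_pow]
    simp)
  refine ⟨b, ?_⟩
  have : b ^ p - b = c := by
    simp only [IsRoot, eval_sub, eval_pow, eval_X, eval_add, eval_C] at hb
    linear_combination hb
  exact congrArg Subtype.val this

/-- In a field of characteristic `p`, and in every field if `p = 2`, a permutation of the roots of
`X ^ p - X - c` by field automorphisms has order dividing `p`: it is a translation by an element of
`𝔽_p`, and for `p = 2` there are only two roots. -/
theorem iterate_eq_of_pow_sub_self_eq {L : Type*} [Field L] (hp : p.Prime)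
    (hchar : p = 2 ∨ CharP L p) (σ : L →+* L) {c t : L} (hc : σ c = c) (ht : t ^ p - t = c) :
    σ^[p] t = t := by
  have hσt : σ t ^ p - σ t = t ^ p - t := by rw [← map_pow, ← map_sub, ht, hc]
  rcases hchar with rfl | hchar
  · have h : (σ t - t) * (σ t - (1 - t)) = 0 := by linear_combination hσt
    rcases mul_eq_zero.1 h with h | h <;> rw [sub_eq_zero] at h <;> simp [h]
  · have := Fact.mk hp
    obtain ⟨i, hi⟩ := exists_natCast_eq_of_pow_eq_self p (x := σ t - t)
      (by rw [sub_pow_char]; linear_combination hσt)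
    have h : ∀ m : ℕ, σ^[m] t = t + m * i := by
      intro m
      induction m with
      | zero => simp
      | succ m ih =>
        rw [Function.iterate_succ_apply', ih, map_add, map_mul, map_natCast, map_natCast]
        push_cast
        linear_combination -hi
    rw [h, CharP.cast_eq_zero, zero_mul, add_zero]

/-- If the valuation extends uniquely to Galois extensions of `p`-power degree, Hensel's lemma
holds for Artin–Schreier polynomials. The splitting field `L` is such an extension. Its
valuation ring is stable under the Galois group, so a root that is congruent to an element of `K`
is congruent to its conjugates, and hence equal to them. -/
theorem ExtendsUniquelyToPExtensions.exists_pow_sub_self_eq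
    (h : ExtendsUniquelyToPExtensions val p) (hp : p.Prime) (hchar : p = 2 ∨ CharP K p)
    [CharP (IsLocalRing.ResidueField val.valuationSubring) p] {a c : val.valuationSubring}
    (hac : a ^ p - a - c ∈ IsLocalRing.maximalIdeal val.valuationSubring) :
    ∃ t : K, t ^ p - t = c := by
  have := Fact.mk hp
  let f : K[X] := X ^ p - (X + C (c : K))
  have hf : f.Monic := monic_X_pow_sub (by rw [degree_X_add_C]; exact_mod_cast hp.one_lt)
  have hfdeg : f.natDegree = p := by
    rw [natDegree_sub_eq_left_of_natDegree_lt] <;> simp [hp.one_lt]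
  have hsep : f.Separable := by
    rcases hchar with rfl | hchar
    · -- The discriminant `1 + 4 c` is a unit of the valuation ring.
      have hd : (1 + 4 * c : K) ≠ 0 := by
        intro h0
        have h0' : 1 + 4 * c = 0 := Subtype.ext (by push_cast; exact h0)
        have h2 : ((2 : ℕ) : IsLocalRing.ResidueField val.valuationSubring) = 0 :=
          CharP.cast_eq_zero _ 2
        have := congrArg (IsLocalRing.residue val.valuationSubring) h0'
        simp only [map_add, map_one, map_mul, map_ofNat, map_zero] at this
        refine one_ne_zero (α := IsLocalRing.ResidueField val.valuationSubring) ?_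
        push_cast at h2
        linear_combination this - 2 * IsLocalRing.residue _ c * h2
      refine ⟨C (-4 * (1 + 4 * (c : K))⁻¹), C ((1 + 4 * (c : K))⁻¹) * (2 * X - 1), ?_⟩
      have hC : (C ((1 + 4 * (c : K))⁻¹) : K[X]) * (1 + 4 * C (c : K)) = 1 := by
        rw [show (4 : K[X]) = C 4 from rfl, ← C_mul, ← C_1, ← C_add, ← C_mul,
          inv_mul_cancel₀ hd]
      have h4 : (C (-4 * (1 + 4 * (c : K))⁻¹) : K[X]) = -4 * C ((1 + 4 * (c : K))⁻¹) := by
        rw [show (-4 : K[X]) = C (-4) by rw [C_neg]; rfl, ← C_mul]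
      have hder : derivative f = 2 * X - 1 := by
        simp only [f, derivative_sub, derivative_X_sq, derivative_add, derivative_X, derivative_C,
          add_zero, map_ofNat]
      rw [hder, h4]
      simp only [f]
      linear_combination hC
    · have hder : derivative f = -1 := by
        simp only [f, derivative_sub, derivative_X_pow, CharP.cast_eq_zero]
        simp
      exact ⟨0, -1, by rw [hder]; ring⟩
  let L := f.SplittingField
  have hroot : ∀ t : L, aeval t f = 0 ↔ t ^ p - t = algebraMap K L c := by
    intro t
    simp only [f, map_sub, map_pow, aeval_X, map_add, aeval_C]
    rw [← sub_sub, sub_eq_zero]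
  have : IsGalois K L := IsGalois.of_separable_splitting_field hsep
  have hcharL : p = 2 ∨ CharP L p :=
    hchar.imp_right fun (_ : CharP K p) =>
      charP_of_injective_algebraMap (algebraMap K L).injective p
  -- The Galois group has exponent `p`, so it is a `p`-group and `L` has `p`-power degree.
  have hpow : ∀ σ : Gal(L/K), σ ^ p = 1 := by
    intro σ
    have h1 : Set.EqOn (σ ^ p : Gal(L/K)) (1 : Gal(L/K)) (f.rootSet L) := by
      intro t ht
      have ht' := (hroot t).1 (aeval_eq_zero_of_mem_rootSet ht)
      have := iterate_eq_of_pow_sub_self_eq hp hcharL (σ : L →+* L) (σ.commutes c) ht'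
      rw [AlgEquiv.coe_pow]
      exact this
    have h2 : ((σ ^ p : Gal(L/K)) : L →ₐ[K] L) = ((1 : Gal(L/K)) : L →ₐ[K] L) :=
      AlgHom.ext_of_adjoin_eq_top (SplittingField.adjoin_rootSet f) h1
    exact AlgEquiv.ext fun x => DFunLike.congr_fun h2 x
  have hrank : ∃ r : ℕ, Module.finrank K L = p ^ r := by
    rw [← IsGalois.card_aut_eq_finrank]
    exact IsPGroup.iff_card.1 fun σ => ⟨1, by rw [pow_one, hpow]⟩
  obtain ⟨B, hB, hBuniq⟩ := h L hrank
  have hmem : ∀ x : K, algebraMap K L x ∈ B ↔ x ∈ val.valuationSubring := by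
    intro x
    rw [← hB, ValuationSubring.mem_comap]
  have hσB : ∀ (σ : Gal(L/K)) (x : L), σ x ∈ B ↔ x ∈ B := by
    intro σ x
    have := hBuniq (B.comap (σ : L →+* L)) (by
      ext y
      simp [ValuationSubring.mem_comap, hmem])
    conv_rhs => rw [← this]
    rfl
  -- The inclusion of the valuation rings is local and induces an extension of residue fields.
  let φ : val.valuationSubring →+* B :=
    ((algebraMap K L).comp val.valuationSubring.subtype).codRestrict B.toSubring
      fun x => (hmem x).2 x.2
  have hφ : ∀ x, ((φ x : B) : L) = algebraMap K L x := fun x => rfl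
  have : IsLocalHom φ := by
    refine ⟨fun x hx => ?_⟩
    obtain ⟨y, hy⟩ := hx.exists_right_inv
    have hy' : algebraMap K L x * y = 1 := congrArg Subtype.val hy
    have hx0 : (x : K) ≠ 0 := by
      rintro h0
      rw [h0, map_zero, zero_mul] at hy'
      exact zero_ne_one hy'
    have hinv : (x : K)⁻¹ ∈ val.valuationSubring := by
      rw [← hmem, map_inv₀, inv_eq_of_mul_eq_one_right hy']
      exact y.2
    exact IsUnit.of_mul_eq_one ⟨_, hinv⟩ (Subtype.ext (mul_inv_cancel₀ hx0))
  have : CharP (IsLocalRing.ResidueField B) p :=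
    charP_of_injective_ringHom (IsLocalRing.ResidueField.map φ).injective p
  obtain ⟨t, ht⟩ : ∃ t : L, t ^ p - t = algebraMap K L c := by
    obtain ⟨t, ht⟩ := (SplittingField.splits f).exists_eval_eq_zero (by
      rw [degree_map, degree_eq_natDegree hf.ne_zero, hfdeg]
      exact_mod_cast hp.ne_zero)
    exact ⟨t, (hroot t).1 (by rwa [eval_map_algebraMap] at ht)⟩
  have htB : t ∈ B := B.mem_of_pow_sub_self_mem hp (by rw [ht]; exact (hmem c).2 c.2)
  -- After translation by an element of `𝔽_p`, the approximate root `a` is congruent to `t`.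
  obtain ⟨a', ha'⟩ : ∃ a' : val.valuationSubring,
      (⟨t, htB⟩ : B) - φ a' ∈ IsLocalRing.maximalIdeal B := by
    have htB' : (⟨t, htB⟩ : B) ^ p - ⟨t, htB⟩ = φ c := Subtype.ext ht
    have hac' : IsLocalRing.residue B (φ a ^ p - φ a - φ c) = 0 := by
      rw [← map_pow, ← map_sub, ← map_sub, ← IsLocalRing.ResidueField.map_residue,
        (IsLocalRing.residue_eq_zero_iff _).2 hac, map_zero]
    obtain ⟨i, hi⟩ := exists_natCast_eq_of_pow_eq_self p
      (x := IsLocalRing.residue B (⟨t, htB⟩ - φ a)) (by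
        have := congrArg (IsLocalRing.residue B) htB'
        simp only [map_sub, map_pow] at this hac' ⊢
        rw [sub_pow_char]
        linear_combination this - hac')
    refine ⟨a + i, ?_⟩
    rw [← IsLocalRing.residue_eq_zero_iff, map_add, ← sub_sub, map_sub, ← hi]
    simp
  have hfix : ∀ σ : Gal(L/K), σ t = t := by
    intro σ
    have hσt : σ t ^ p - σ t = t ^ p - t := by rw [← map_pow, ← map_sub, ht, σ.commutes]
    have hσa : (⟨σ t, (hσB σ t).2 htB⟩ : B) - φ a' ∈ IsLocalRing.maximalIdeal B := by
      rw [← ValuationSubring.coe_mem_nonunits_iff, ValuationSubring.mem_nonunits_iff_or] at ha' ⊢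
      have : ((⟨σ t, (hσB σ t).2 htB⟩ - φ a' : B) : L) = σ ((⟨t, htB⟩ - φ a' : B) : L) := by
        push_cast
        rw [map_sub, hφ, σ.commutes]
      rwa [this, ← map_inv₀, hσB, map_eq_zero]
    have := eq_of_pow_sub_self_eq_of_sub_mem (p := p) (R := B) (t := ⟨σ t, (hσB σ t).2 htB⟩)
      (u := ⟨t, htB⟩) (Subtype.ext hσt) (by simpa using sub_mem hσa ha')
    exact congrArg Subtype.val this
  obtain ⟨u, hu⟩ := IntermediateField.mem_bot.1 ((IsGalois.mem_bot_iff_fixed t).2 hfix)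
  refine ⟨u, (algebraMap K L).injective ?_⟩
  rw [map_sub, map_pow, hu, ht]

variable [CharP (IsLocalRing.ResidueField val.valuationSubring) p]

/-- For `p`-henselian valuations, solvability of `t ^ p - t = c` in `K` can be read off in the
residue field. -/
theorem exists_pow_sub_self_eq_iff_residue (hp : p.Prime)
    (hens : IsPHenselian val p ∨ (ExtendsUniquelyToPExtensions val p ∧ (p = 2 ∨ CharP K p)))
    (c : val.valuationSubring) :
    (∃ t : K, t ^ p - t = c) ↔
      ∃ s, s ^ p - s = IsLocalRing.residue val.valuationSubring c := by
  constructor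
  · rintro ⟨t, ht⟩
    have htO : t ∈ val.valuationSubring :=
      ValuationSubring.mem_of_pow_sub_self_mem _ hp (by rw [ht]; exact c.2)
    refine ⟨IsLocalRing.residue _ ⟨t, htO⟩, ?_⟩
    rw [← map_pow, ← map_sub]
    exact congrArg _ (Subtype.ext ht)
  · rintro ⟨s, hs⟩
    obtain ⟨a, rfl⟩ := IsLocalRing.residue_surjective s
    have hac : a ^ p - a - c ∈ IsLocalRing.maximalIdeal val.valuationSubring := by
      rw [← IsLocalRing.residue_eq_zero_iff, map_sub, map_sub, map_pow, hs, sub_self]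
    rcases hens with h | ⟨h, hchar⟩
    · exact h.exists_pow_sub_self_eq hp hac
    · exact h.exists_pow_sub_self_eq hp hchar hac

end

/-! ### The independence property -/

/-- The finite pattern in `K`: the parameters `a k j = (x ^ (j m ^ k)) ^ (-q)`, for a lift `x` of an
element of large degree over `𝔽_p`, have products over the cube `{0, …, m - 1} ^ n` that are inverse
`q`-th powers of different members of the independent family `1, x, x ^ 2, …`. -/
theorem exists_artinSchreier_pattern {K : Type u} [Field K] {Γ : Type v}
    [LinearOrderedCommGroupWithZero Γ] (val : Valuation K Γ) (p : ℕ) (hp : p.Prime)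
    (hens : IsPHenselian val p ∨
      (ExtendsUniquelyToPExtensions val p ∧ (p = 2 ∨ CharP K p)))
    [CharP (IsLocalRing.ResidueField val.valuationSubring) p]
    [Infinite (IsLocalRing.ResidueField val.valuationSubring)]
    (hAS : ¬ IsASClosed (IsLocalRing.ResidueField val.valuationSubring) p) (n m : ℕ) :
    ∃ (a : Fin n → ℕ → K) (b : Set (Fin n → ℕ) → K),
      ∀ (J : Set (Fin n → ℕ)) (i : Fin n → ℕ), (∀ k, i k < m) →
        ((∃ t : K, b J = (∏ k, a k (i k)) * (t ^ p - t)) ↔ i ∈ J) := by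
  have := Fact.mk hp
  let := ZMod.algebra (IsLocalRing.ResidueField val.valuationSubring) p
  simp only [IsASClosed, not_forall, not_exists] at hAS
  obtain ⟨x, hx0, hx⟩ := exists_linearIndependent_pow
    (IsLocalRing.ResidueField val.valuationSubring) p (m ^ n)
  obtain ⟨q, hq⟩ := exists_forall_mul_mem_range_artinSchreierHom_iff p _ hx hAS
  obtain ⟨x, rfl⟩ := IsLocalRing.residue_surjective x
  choose b hb using hq
  choose b' hb' using fun s => IsLocalRing.residue_surjective
    (R := val.valuationSubring) (b s)
  have hxK : (x : K) ≠ 0 := by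
    intro h
    exact hx0 (by rw [show x = 0 from Subtype.ext h, map_zero])
  -- A point of the cube is encoded by the number with its coordinates as digits in base `m`, so
  -- that different points give different exponents `d < m ^ n`.
  let code : Set (Fin n → ℕ) → Set (Fin (m ^ n)) :=
    fun J => {d | (fun k => ((finFunctionFinEquiv.symm d : Fin n → Fin m) k : ℕ)) ∈ J}
  refine ⟨fun k j => (((x : K) ^ (j * m ^ (k : ℕ))) ^ q)⁻¹,
    fun J => b' (code J), fun J i hi => ?_⟩
  let d : Fin (m ^ n) := finFunctionFinEquiv fun k => (⟨i k, hi k⟩ : Fin m)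
  have hd : (d : ℕ) = ∑ k, i k * m ^ (k : ℕ) := finFunctionFinEquiv_apply _
  have hdJ : d ∈ code J ↔ i ∈ J := by
    rw [Set.mem_ofPred_eq, Equiv.symm_apply_apply]
  rw [← hdJ, ← hb]
  have hprod : ∏ k, (((x : K) ^ (i k * m ^ (k : ℕ))) ^ q)⁻¹ = (((x : K) ^ (d : ℕ)) ^ q)⁻¹ := by
    rw [Finset.prod_inv_distrib, Finset.prod_pow, Finset.prod_pow_eq_pow_sum, hd]
  rw [hprod]
  let c : val.valuationSubring := (x ^ (d : ℕ)) ^ q * b' (code J)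
  have h := exists_pow_sub_self_eq_iff_residue hp hens c
  have hc : IsLocalRing.residue val.valuationSubring c =
      (IsLocalRing.residue val.valuationSubring x ^ (d : ℕ)) ^ q *
        b (code J) := by
    rw [map_mul, map_pow, map_pow, hb']
  rw [hc] at h
  have hpow : ((x : K) ^ (d : ℕ)) ^ q ≠ 0 := pow_ne_zero _ (pow_ne_zero _ hxK)
  simp only [AddMonoidHom.mem_range, artinSchreierHom_apply]
  rw [← h]
  refine exists_congr fun t => ?_
  rw [eq_inv_mul_iff_mul_eq₀ hpow, eq_comm]
  exact Iff.rfl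

theorem mainTheorem8 {K : Type u} [Field K] {Γ : Type v} [LinearOrderedCommGroupWithZero Γ]
    (val : Valuation K Γ) (p : ℕ) (hp : p.Prime)
    (hens : IsPHenselian val p ∨
      (ExtendsUniquelyToPExtensions val p ∧ (p = 2 ∨ CharP K p)))
    (hchar : CharP (IsLocalRing.ResidueField val.valuationSubring) p)
    (hinf : Infinite (IsLocalRing.ResidueField val.valuationSubring))
    (hAS : ¬ IsASClosed (IsLocalRing.ResidueField val.valuationSubring) p)
    (n : ℕ) (hn : 1 ≤ n) :
    (pureFieldTheory K).HasIP n ∧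
      (pureFieldTheory K).FormulaHasIP (artinSchreierFormula n p) := by
  suffices h : (pureFieldTheory K).FormulaHasIP (artinSchreierFormula n p) from
    ⟨⟨1, 1, artinSchreierFormula n p, h⟩, h⟩
  let := Ring.compatibleRingOfRing K
  refine Language.Theory.FormulaHasIP.of_finite fun m => ?_
  obtain ⟨a, b, hab⟩ := exists_artinSchreier_pattern val p hp hens hAS n m
  refine ⟨fun k j _ => a k j, fun J _ => b J, fun J i hi => ?_⟩
  rw [realize_artinSchreierFormula]
  exact hab J i hi
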